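/- Let $\mathfrak A$ be the CAR algebra of the one-dimensional fermion lattice system: the unital $C^*$-algebra generated by $c_j$ ($j\in\mathbb Z$) with $c_ic_j+c_jc_i=0$ and $c_i^*c_j+c_jc_i^*=\delta_{ij}1$. For finite $I\subset\mathbb Z$ let $\mathfrak A(I)$ be the unital $*$-algebra generated by $\{c_i,c_i^*: i\in I\}$, and let $\mathfrak A_\circ=\bigcup_{I\subset\mathbb Z\text{ finite}}\mathfrak A(I)$, the set of strictly local operators. For $i\in\mathbb Z$ let $\tau_i$ be the automorphism of $\mathfrak A$ with $\tau_i(c_j)=c_{j+i}$ for all $j\in\mathbb Z$. For $f\in\ell^2(\mathbb Z)$ put $c(f)=\sum_j f_jc_j$ and $c^*(f)=\sum_j f_jc_j^*$ (norm-convergent sums, both linear in $f$), and let $U_t$ ($t\in\mathbb R$) be the unitary on $\ell^2(\mathbb Z)$ which, under the Fourier transformation $\tilde f(k)=\sum_j f_je^{ijk}$ onto $L^2([-\pi,\pi],dk/2\pi)$, is multiplication by $e^{itk}$. Then the discrete shift group $\{\tau_i\}_{i\in\mathbb Z}$ extends to a quasi-free $C^*$-flow on $\mathfrak A$, i.e.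 there is a strongly continuous one-parameter group $\{\tau_t\}_{t\in\mathbb R}$ of $*$-automorphisms of $\mathfrak A$ that agrees with $\tau_i$ at $t=i\in\mathbb Z$ and is the second quantization of the strongly continuous one-parameter unitary group $\{U_t\}$: $\tau_t(c(f))=c(U_tf)$ and $\tau_t(c^*(f))=c^*(U_tf)$ for all $t\in\mathbb R$, $f\in\ell^2(\mathbb Z)$. It has the following properties. 1. For $j\in\mathbb Z$ and $t\in\mathbb R\setminus\mathbb Z$, with $\operatorname{sinc}x=\frac{\sin x}{x}$ and norm-convergent sums, $$\tau_t(c_j)=\sum_{l\in\mathbb Z}\operatorname{sinc}(\pi(j+t-l))\,c_l=\sum_{l\in\mathbb Z}\frac{(-1)^{j-l}\sin(\pi t)}{\pi(j+t-l)}\,c_l,$$ $$\tau_t(c_j^*)=\sum_{l\in\mathbb Z}\operatorname{sinc}(\pi(j+t-l))\,c_l^*=\sum_{l\in\mathbb Z}\frac{(-1)^{j-l}\sin(\pi t)}{\pi(j+t-l)}\,c_l^*.$$ 2. For $j,k\in\mathbb Z$, $\tau_k(c_j)=c_{j+k}\in\mathfrak A_\circ$ and $\tau_k(c_j^*)=c_{j+k}^*\in\mathfrak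 A_\circ$. 3. For every $t\in\mathbb R\setminus\mathbb Z$ the automorphism $\tau_t$ violates locality: there is $A\in\mathfrak A_\circ$ with $\tau_t(A)\notin\mathfrak A_\circ$. -/

import Mathlib

noncomputable section

open MeasureTheory

namespace ShiftFlow

/-- The Hilbert space `ℓ²(α)` of square-summable complex families. -/
abbrev EllTwo (α : Type) : Type := lp (fun _ : α => ℂ) 2

/-- The fermionic Fock space over `ℓ²(ℤ)` in the occupation-number basis: the basis vector
indexed by a finite set `S ⊂ ℤ` is the state in which exactly the sites of `S` are occupied. -/
abbrev Fock : Type := EllTwo (Finset ℤ)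

/-- The Jordan--Wigner sign `(-1) ^ #{i ∈ S | i < j}`. -/
def jwSign (j : ℤ) (S : Finset ℤ) : ℂ := (-1) ^ (S.filter (· < j)).card

/-- `(c_j ψ)(S) = (-1) ^ #{i ∈ S | i < j} ψ(S ∪ {j})` if `j ∉ S`, and `0` if `j ∈ S`; that is,
`c_j` sends the basis vector of `S ∋ j` to `±` that of `S \ {j}` and kills that of `S ∌ j`. -/
def annihilationFun (j : ℤ) (ψ : Finset ℤ → ℂ) (S : Finset ℤ) : ℂ :=
  if j ∈ S then 0 else jwSign j S * ψ (insert j S)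

theorem norm_jwSign (j : ℤ) (S : Finset ℤ) : ‖jwSign j S‖ = 1 := by
  simp [jwSign]

theorem sum_annihilationFun_le (j : ℤ) (ψ : Fock) (s : Finset (Finset ℤ)) :
    ∑ S ∈ s, ‖annihilationFun j ψ S‖ ^ (2 : ENNReal).toReal
      ≤ ‖ψ‖ ^ (2 : ENNReal).toReal := by
  classical
  have h1 : ∑ S ∈ s, ‖annihilationFun j ψ S‖ ^ (2 : ENNReal).toReal
      = ∑ S ∈ s.filter (fun S => j ∉ S), ‖ψ (insert j S)‖ ^ (2 : ENNReal).toReal := by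
    rw [Finset.sum_filter]
    refine Finset.sum_congr rfl fun S _ => ?_
    by_cases h : j ∈ S <;> simp [annihilationFun, h, norm_jwSign]
  have hinj : Set.InjOn (fun S : Finset ℤ => insert j S)
      (s.filter (fun S => j ∉ S) : Finset (Finset ℤ)) := by
    intro S hS T hT h
    simp only [Finset.coe_filter, Set.mem_ofPred_eq] at hS hT
    have := congrArg (fun X => Finset.erase X j) h
    simpa [Finset.erase_insert hS.2, Finset.erase_insert hT.2] using this
  rw [h1, ← Finset.sum_image (f := fun T => ‖ψ T‖ ^ (2 : ENNReal).toReal) hinj]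
  exact lp.sum_rpow_le_norm_rpow (by simp) ψ _

/-- The annihilation operator `c_j` of a fermion at the site `j`, on Fock space. -/
def annihilation (j : ℤ) : Fock →L[ℂ] Fock :=
  LinearMap.mkContinuous
    { toFun := fun ψ => ⟨annihilationFun j ψ, memℓp_gen' (sum_annihilationFun_le j ψ)⟩
      map_add' := fun ψ φ => by
        ext S
        change annihilationFun j (fun T => ψ T + φ T) S
          = annihilationFun j ψ S + annihilationFun j φ S
        by_cases h : j ∈ S <;> simp [annihilationFun, h, mul_add]
      map_smul' := fun z ψ => by
        ext S
        change annihilationFun j (fun T => z * ψ T) S = z * annihilationFun j ψ S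
        by_cases h : j ∈ S <;> simp [annihilationFun, h, mul_left_comm] }
    1 (fun ψ => by
      rw [one_mul]
      exact lp.norm_le_of_forall_sum_le (by simp) (norm_nonneg _) (sum_annihilationFun_le j ψ))

/-- The CAR algebra of the fermion lattice system on `ℤ`, realised on Fock space: the closure
in operator norm of the unital `*`-algebra generated by all `c_j`, `c_j^*`. -/
def carStarSubalgebra : StarSubalgebra ℂ (Fock →L[ℂ] Fock) :=
  (StarAlgebra.adjoin ℂ (Set.range annihilation)).topologicalClosure

/-- The CAR algebra as a type; it carries the operator norm. -/
abbrev CAR : Type := ↥carStarSubalgebra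

/-- The generator `c_j` of the CAR algebra; `star (c j)` is the creation operator `c_j^*`. -/
def c (j : ℤ) : CAR :=
  ⟨annihilation j, StarSubalgebra.le_topologicalClosure _
    (StarAlgebra.subset_adjoin ℂ _ (Set.mem_range_self j))⟩

/-! ### The canonical anticommutation relations hold -/

theorem annihilation_apply (j : ℤ) (ψ : Fock) (S : Finset ℤ) :
    annihilation j ψ S = annihilationFun j ψ S := rfl

theorem jwSign_insert {i j : ℤ} {S : Finset ℤ} (hi : i ∉ S) :
    jwSign j (insert i S) = if i < j then -jwSign j S else jwSign j S := by
  unfold jwSign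
  rw [Finset.filter_insert]
  split_ifs with h
  · rw [Finset.card_insert_of_notMem (by simp [hi]), pow_succ]; ring
  · rfl

theorem jwSign_mul_self (j : ℤ) (S : Finset ℤ) : jwSign j S * jwSign j S = 1 := by
  unfold jwSign; rw [← pow_add, ← two_mul, pow_mul]; simp

theorem star_annihilation_apply (j : ℤ) (ψ : Fock) (S : Finset ℤ) :
    (star (annihilation j) : Fock →L[ℂ] Fock) ψ S
      = if j ∈ S then jwSign j (S.erase j) * ψ (S.erase j) else 0 := by
  classical
  have h1 : (star (annihilation j) : Fock →L[ℂ] Fock) ψ S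
      = inner ℂ (lp.single 2 S (1 : ℂ) : Fock) ((star (annihilation j) : Fock →L[ℂ] Fock) ψ) := by
    rw [lp.inner_single_left]; simp
  have h2 : annihilation j (lp.single 2 S (1 : ℂ) : Fock)
      = if j ∈ S then lp.single 2 (S.erase j) (jwSign j (S.erase j)) else (0 : Fock) := by
    ext T
    rw [annihilation_apply, annihilationFun]
    by_cases hT : j ∈ T
    · by_cases hS : j ∈ S
      · have : T ≠ S.erase j := by rintro rfl; simp at hT
        simp [hT, hS, lp.single_apply, this]
      · simp [hT, hS]
    · by_cases hS : j ∈ S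
      · by_cases hE : T = S.erase j
        · subst hE; simp [hS, lp.single_apply, Finset.insert_erase]
        · have : insert j T ≠ S := by rintro rfl; exact hE (by simp [hT])
          simp [hT, hS, lp.single_apply, hE, this]
      · have : insert j T ≠ S := by rintro rfl; simp at hS
        simp [hT, hS, lp.single_apply, this]
  rw [h1, ContinuousLinearMap.star_eq_adjoint, ContinuousLinearMap.adjoint_inner_right, h2]
  split_ifs with h
  · rw [lp.inner_single_left]
    simp [jwSign, mul_comm]
  · simp

theorem c_anticomm (i j : ℤ) : c i * c j + c j * c i = 0 := by
  refine Subtype.ext ?_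
  ext ψ S
  change annihilationFun i (annihilation j ψ) S + annihilationFun j (annihilation i ψ) S = 0
  simp only [annihilationFun, annihilation_apply]
  rcases lt_trichotomy i j with h | h | h
  · by_cases hi : i ∈ S <;> by_cases hj : j ∈ S <;>
      simp [hi, hj, jwSign_insert, h, h.ne, h.ne', h.not_gt, Finset.insert_comm i j]; ring
  · subst h; simp
  · by_cases hi : i ∈ S <;> by_cases hj : j ∈ S <;>
      simp [hi, hj, jwSign_insert, h, h.ne, h.ne', h.not_gt, Finset.insert_comm i j]; ring

theorem c_star_anticomm (i j : ℤ) :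
    star (c i) * c j + c j * star (c i) = if i = j then 1 else 0 := by
  refine Subtype.ext ?_
  ext ψ S
  have key : (star (annihilation i) : Fock →L[ℂ] Fock) (annihilation j ψ) S
      + annihilation j ((star (annihilation i) : Fock →L[ℂ] Fock) ψ) S
      = if i = j then ψ S else 0 := by
    rw [star_annihilation_apply, annihilation_apply, annihilation_apply]
    simp only [annihilationFun, star_annihilation_apply]
    by_cases hij : i = j
    · subst hij
      by_cases hi : i ∈ S
      · simp [hi, ← mul_assoc, jwSign_mul_self]
      · simp [hi, ← mul_assoc, jwSign_mul_self]
    · by_cases hi : i ∈ S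
      · obtain ⟨T, hT, rfl⟩ : ∃ T, i ∉ T ∧ S = insert i T :=
          ⟨S.erase i, by simp, (Finset.insert_erase hi).symm⟩
        by_cases hj : j ∈ T
        · simp [hij, hj, hT, Ne.symm hij]
        · have e : (insert j (insert i T)).erase i = insert j T := by
            rw [Finset.insert_comm, Finset.erase_insert (by simp [hij, hT])]
          rcases lt_or_gt_of_ne hij with h | h <;>
            simp [hij, hj, hT, Ne.symm hij, e, jwSign_insert, h, h.not_gt] <;> ring
      · by_cases hj : j ∈ S <;> simp [hij, hi, hj]
  by_cases hij : i = j
  · rw [if_pos hij] at key ⊢; exact key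
  · rw [if_neg hij] at key ⊢; exact key

/-- The algebra of the finite region `I`: the `*`-algebra generated by `c_i`, `c_i^*`, `i ∈ I`. -/
def localAt (I : Finset ℤ) : StarSubalgebra ℂ CAR :=
  StarAlgebra.adjoin ℂ (c '' (I : Set ℤ))

/-- The local algebra: the set of all strictly local operators, the union of the algebras of
the finite regions. -/
def localAlgebra : Set CAR := ⋃ I : Finset ℤ, (localAt I : Set CAR)

/-- Automorphisms (`*`-preserving, complex linear) of the CAR algebra. -/
abbrev Aut : Type := CAR ≃⋆ₐ[ℂ] CAR

/-! ### The discrete shift -/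

theorem sum_relabel_le {α : Type} (e : α ≃ α) (ψ : EllTwo α) (s : Finset α) :
    ∑ a ∈ s, ‖ψ (e.symm a)‖ ^ (2 : ENNReal).toReal ≤ ‖ψ‖ ^ (2 : ENNReal).toReal := by
  have h := lp.sum_rpow_le_norm_rpow (by simp) ψ (s.map e.symm.toEmbedding)
  rwa [Finset.sum_map] at h

/-- Relabelling of coordinates, `(ψ_a) ↦ (ψ_{e⁻¹ a})`, as a linear map. -/
def relabelLin {α : Type} (e : α ≃ α) : EllTwo α →ₗ[ℂ] EllTwo α where
  toFun := fun ψ => ⟨fun a => ψ (e.symm a), memℓp_gen' (sum_relabel_le e ψ)⟩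
  map_add' := fun _ _ => rfl
  map_smul' := fun _ _ => rfl

theorem relabelLin_apply {α : Type} (e : α ≃ α) (ψ : EllTwo α) (a : α) :
    relabelLin e ψ a = ψ (e.symm a) := rfl

theorem norm_relabelLin_le {α : Type} (e : α ≃ α) (ψ : EllTwo α) : ‖relabelLin e ψ‖ ≤ ‖ψ‖ :=
  lp.norm_le_of_forall_sum_le (by simp) (norm_nonneg _) (sum_relabel_le e ψ)

theorem relabelLin_symm_relabelLin {α : Type} (e : α ≃ α) (ψ : EllTwo α) :
    relabelLin e.symm (relabelLin e ψ) = ψ := by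
  ext a; simp [relabelLin_apply]

/-- Relabelling of coordinates as a unitary. -/
def relabel {α : Type} (e : α ≃ α) : EllTwo α ≃ₗᵢ[ℂ] EllTwo α where
  toLinearEquiv := LinearEquiv.ofLinearMap (relabelLin e) (relabelLin e.symm)
    (by ext1 ψ; exact relabelLin_symm_relabelLin e.symm ψ)
    (by ext1 ψ; exact relabelLin_symm_relabelLin e ψ)
  norm_map' := fun ψ => by
    refine le_antisymm (norm_relabelLin_le e ψ) ?_
    have h := norm_relabelLin_le e.symm (relabelLin e ψ)
    rwa [relabelLin_symm_relabelLin] at h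

/-- Translation by `i` of finite subsets of `ℤ`. -/
def translate (i : ℤ) : Finset ℤ ≃ Finset ℤ := (Equiv.addRight i).finsetCongr

/-- The unitary on Fock space that translates all particles by `i` sites. -/
def fockShift (i : ℤ) : Fock ≃ₗᵢ[ℂ] Fock := relabel (translate i)

theorem mem_translate_symm (i j : ℤ) (S : Finset ℤ) :
    j ∈ (translate i).symm S ↔ j + i ∈ S := by
  simp [translate, Equiv.finsetCongr, Finset.mem_map_equiv]

theorem fockShift_annihilation (i j : ℤ) :
    (fockShift i).conjStarAlgEquiv (annihilation j) = annihilation (j + i) := by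
  ext ψ S
  change annihilationFun j (fun T => ψ ((translate i).symm.symm T)) ((translate i).symm S)
    = annihilationFun (j + i) ψ S
  have h1 : (translate i) (insert j ((translate i).symm S)) = insert (j + i) S := by
    rw [← Equiv.eq_symm_apply]
    ext k
    rw [Finset.mem_insert, mem_translate_symm, mem_translate_symm, Finset.mem_insert]
    simp
  have h2 : jwSign j ((translate i).symm S) = jwSign (j + i) S := by
    unfold jwSign
    congr 1
    refine Finset.card_bij (fun k _ => k + i) ?_ ?_ ?_
    · intro k hk
      simpa [mem_translate_symm] using hk
    · intro a _ b _ h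
      simpa using h
    · intro b hb
      refine ⟨b - i, ?_, by simp⟩
      simp only [Finset.mem_filter, mem_translate_symm, sub_add_cancel] at hb ⊢
      exact ⟨hb.1, by linarith [hb.2]⟩
  simp only [annihilationFun, mem_translate_symm, Equiv.symm_symm, h1, h2]

theorem fockShift_mem (i : ℤ) {x : Fock →L[ℂ] Fock} (hx : x ∈ carStarSubalgebra) :
    (fockShift i).conjStarAlgEquiv x ∈ carStarSubalgebra := by
  have hcont : Continuous ((fockShift i).conjStarAlgEquiv : (Fock →L[ℂ] Fock) → _) := by
    change Continuous fun x : Fock →L[ℂ] Fock =>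
      ((fockShift i : Fock →L[ℂ] Fock) ∘L x ∘L ((fockShift i).symm : Fock →L[ℂ] Fock))
    fun_prop
  have hle : carStarSubalgebra ≤ carStarSubalgebra.comap
      ((fockShift i).conjStarAlgEquiv : (Fock →L[ℂ] Fock) →⋆ₐ[ℂ] (Fock →L[ℂ] Fock)) := by
    refine StarSubalgebra.topologicalClosure_minimal ?_ ?_
    · refine StarAlgebra.adjoin_le ?_
      rintro _ ⟨j, rfl⟩
      change (fockShift i).conjStarAlgEquiv (annihilation j) ∈ carStarSubalgebra
      rw [fockShift_annihilation]
      exact (c (j + i)).2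
    · exact (StarSubalgebra.isClosed_topologicalClosure _).preimage hcont
  exact hle hx

theorem fockShift_symm_apply (i : ℤ) (x : Fock →L[ℂ] Fock) :
    (fockShift (-i)).conjStarAlgEquiv x = (fockShift i).conjStarAlgEquiv.symm x := by
  have h : ∀ (ψ : Fock), fockShift (-i) ψ = (fockShift i).symm ψ := by
    intro ψ
    ext S
    change ψ ((translate (-i)).symm S) = ψ ((translate i) S)
    refine congrArg ψ ?_
    rw [← Equiv.symm_apply_eq]
    ext k
    simp [mem_translate_symm]
  have h' : fockShift (-i) = (fockShift i).symm := LinearIsometryEquiv.ext h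
  rw [h']
  rfl

/-- The discrete shift automorphism `τ_i`, implemented by the translation of Fock space; it is
the automorphism of the CAR algebra with `τ_i (c_j) = c_{j+i}`. -/
def discreteShift (i : ℤ) : Aut where
  toFun := fun x => ⟨(fockShift i).conjStarAlgEquiv x, fockShift_mem i x.2⟩
  invFun := fun x => ⟨(fockShift (-i)).conjStarAlgEquiv x, fockShift_mem (-i) x.2⟩
  left_inv := fun x => Subtype.ext (by
    simp only [fockShift_symm_apply, StarAlgEquiv.symm_apply_apply])
  right_inv := fun x => Subtype.ext (by
    simp only [fockShift_symm_apply, StarAlgEquiv.apply_symm_apply])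
  map_mul' := fun x y => Subtype.ext (by simp)
  map_add' := fun x y => Subtype.ext (by simp)
  map_star' := fun x => Subtype.ext (by simp [map_star])
  map_smul' := fun z x => Subtype.ext (by simp)

theorem discreteShift_c (i j : ℤ) : discreteShift i (c j) = c (j + i) :=
  Subtype.ext (fockShift_annihilation i j)

/-! ### One-particle unitaries -/

/-- The normalised measure `dk / 2π` on the momentum interval `[-π, π]`. -/
def momentumMeasure : Measure ℝ :=
  ENNReal.ofReal (1 / (2 * Real.pi)) • volume.restrict (Set.Icc (-Real.pi) Real.pi)

instance : IsFiniteMeasure momentumMeasure := by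
  unfold momentumMeasure
  exact Measure.smul_finite _ ENNReal.ofReal_ne_top

/-- The momentum space `L²[-π, π]`, with the measure `dk / 2π`. -/
abbrev MomentumSpace : Type := Lp ℂ 2 momentumMeasure

/-- The function `k ↦ e^{isk}`. -/
def expFun (s : ℝ) (k : ℝ) : ℂ := Complex.exp (s * k * Complex.I)

theorem continuous_expFun (s : ℝ) : Continuous (expFun s) := by
  unfold expFun; fun_prop

theorem norm_expFun (s k : ℝ) : ‖expFun s k‖ = 1 := by
  have := Complex.norm_exp_ofReal_mul_I (s * k)
  simpa [expFun] using this

theorem expFun_mul (s t k : ℝ) : expFun s k * expFun t k = expFun (s + t) k := by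
  unfold expFun
  rw [← Complex.exp_add]
  push_cast
  ring_nf

theorem expFun_zero (k : ℝ) : expFun 0 k = 1 := by simp [expFun]

theorem memLp_expFun_mul (s : ℝ) (g : MomentumSpace) :
    MemLp (fun k => expFun s k * g k) 2 momentumMeasure :=
  (Lp.memLp g).of_le
    ((continuous_expFun s).aestronglyMeasurable.mul (Lp.aestronglyMeasurable g))
    (Filter.Eventually.of_forall fun k => by simp [norm_expFun])

theorem memLp_expFun (s : ℝ) : MemLp (expFun s) 2 momentumMeasure :=
  MemLp.of_bound (continuous_expFun s).aestronglyMeasurable 1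
    (Filter.Eventually.of_forall fun k => (norm_expFun s k).le)

/-- Multiplication by `e^{isk}` on `L²[-π, π]`, as a linear map. -/
def expMulLin (s : ℝ) : MomentumSpace →ₗ[ℂ] MomentumSpace where
  toFun := fun g => (memLp_expFun_mul s g).toLp _
  map_add' := fun g h => by
    rw [← MemLp.toLp_add]
    refine MemLp.toLp_congr _ _ ?_
    filter_upwards [Lp.coeFn_add g h] with k hk
    change expFun s k * (g + h : MomentumSpace) k = expFun s k * g k + expFun s k * h k
    rw [hk, Pi.add_apply, mul_add]
  map_smul' := fun z g => by
    rw [RingHom.id_apply, ← MemLp.toLp_const_smul]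
    refine MemLp.toLp_congr _ _ ?_
    filter_upwards [Lp.coeFn_smul z g] with k hk
    change expFun s k * (z • g : MomentumSpace) k = z * (expFun s k * g k)
    rw [hk, Pi.smul_apply, smul_eq_mul, mul_left_comm]

theorem coeFn_expMulLin (s : ℝ) (g : MomentumSpace) :
    expMulLin s g =ᵐ[momentumMeasure] fun k => expFun s k * g k :=
  MemLp.coeFn_toLp (memLp_expFun_mul s g)

theorem expMulLin_expMulLin (s t : ℝ) (hst : s + t = 0) (g : MomentumSpace) :
    expMulLin s (expMulLin t g) = g := by
  refine Lp.ext ?_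
  filter_upwards [coeFn_expMulLin s (expMulLin t g), coeFn_expMulLin t g] with k h1 h2
  rw [h1, h2, ← mul_assoc, expFun_mul, hst, expFun_zero, one_mul]

/-- Multiplication by `e^{itk}` on `L²[-π, π]`, as a unitary. -/
def expMul (t : ℝ) : MomentumSpace ≃ₗᵢ[ℂ] MomentumSpace where
  toLinearEquiv := LinearEquiv.ofLinearMap (expMulLin t) (expMulLin (-t))
    (by ext1 g; exact expMulLin_expMulLin t (-t) (by ring) g)
    (by ext1 g; exact expMulLin_expMulLin (-t) t (by ring) g)
  norm_map' := fun g => by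
    have h : ∀ᵐ k ∂momentumMeasure, ‖expMulLin t g k‖ = ‖g k‖ := by
      filter_upwards [coeFn_expMulLin t g] with k hk
      rw [hk, norm_mul, norm_expFun, one_mul]
    exact le_antisymm (Lp.norm_le_norm_of_ae_le (h.mono fun _ hk => hk.le))
      (Lp.norm_le_norm_of_ae_le (h.mono fun _ hk => hk.ge))

/-- The exponential `k ↦ e^{ijk}`, `j ∈ ℤ`, as a vector of `L²[-π, π]`. -/
def expVec (j : ℤ) : MomentumSpace := (memLp_expFun j).toLp _

theorem integral_momentumMeasure (g : ℝ → ℂ) :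
    ∫ k, g k ∂momentumMeasure = (1 / (2 * Real.pi)) • ∫ k in (-Real.pi)..Real.pi, g k := by
  rw [momentumMeasure, integral_smul_measure, integral_Icc_eq_integral_Ioc,
    intervalIntegral.integral_of_le (by linarith [Real.pi_pos]),
    ENNReal.toReal_ofReal (by positivity)]

theorem inner_expVec (j : ℤ) (g : MomentumSpace) :
    inner ℂ (expVec j) g = fourierCoeffOn (a := -Real.pi) (b := Real.pi)
      (by linarith [Real.pi_pos]) g j := by
  have h1 : inner ℂ (expVec j) g = ∫ k, expFun (-j) k * g k ∂momentumMeasure := by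
    rw [L2.inner_def]
    refine integral_congr_ae ?_
    filter_upwards [MemLp.coeFn_toLp (memLp_expFun j)] with k hk
    have : (starRingEnd ℂ) (expFun j k) = expFun (-j) k := by
      simp [expFun, ← Complex.exp_conj]
    rw [expVec, hk, RCLike.inner_apply, this, mul_comm]
  rw [h1, integral_momentumMeasure, fourierCoeffOn_eq_integral]
  have h2 : Real.pi - -Real.pi = 2 * Real.pi := by ring
  rw [h2]
  congr 1
  refine intervalIntegral.integral_congr fun k _ => ?_
  simp only [fourier_coe_apply, smul_eq_mul, expFun]
  congr 2
  have : (Real.pi : ℂ) ≠ 0 := by exact_mod_cast Real.pi_ne_zero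
  push_cast
  field_simp

theorem orthonormal_expVec : Orthonormal ℂ expVec := by
  rw [orthonormal_iff_ite]
  intro i j
  have h1 : inner ℂ (expVec i) (expVec j)
      = (1 / (2 * Real.pi)) • ∫ k in (-Real.pi)..Real.pi, expFun (j - i) k := by
    rw [← integral_momentumMeasure, L2.inner_def]
    refine integral_congr_ae ?_
    filter_upwards [MemLp.coeFn_toLp (memLp_expFun i), MemLp.coeFn_toLp (memLp_expFun j)]
      with k hi hj
    have : (starRingEnd ℂ) (expFun i k) = expFun (-i) k := by
      simp [expFun, ← Complex.exp_conj]
    rw [expVec, expVec, hi, hj, RCLike.inner_apply, this, expFun_mul, sub_eq_add_neg]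
  rw [h1]
  have hpi : (Real.pi : ℂ) ≠ 0 := by exact_mod_cast Real.pi_ne_zero
  by_cases h : i = j
  · subst h
    simp only [sub_self, expFun_zero, intervalIntegral.integral_const, if_true]
    rw [smul_smul]
    have : 1 / (2 * Real.pi) * (Real.pi - -Real.pi) = 1 := by
      field_simp [Real.pi_ne_zero]; ring
    rw [this, one_smul]
  · have hd : ((j : ℂ) - i) * Complex.I ≠ 0 := by
      refine mul_ne_zero ?_ Complex.I_ne_zero
      rw [sub_ne_zero]
      exact_mod_cast Ne.symm h
    have h2 : ∀ k : ℝ, expFun (j - i) k = Complex.exp (((j : ℂ) - i) * Complex.I * k) := by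
      intro k
      simp only [expFun]
      push_cast
      ring_nf
    simp only [h2, if_neg h]
    rw [integral_exp_mul_complex hd]
    have h3 : Complex.exp (((j : ℂ) - i) * Complex.I * (Real.pi : ℝ))
        = Complex.exp (((j : ℂ) - i) * Complex.I * ((-Real.pi : ℝ) : ℂ)) := by
      rw [Complex.exp_eq_exp_iff_exists_int]
      refine ⟨j - i, ?_⟩
      push_cast
      ring
    rw [h3]
    simp

theorem orthogonal_expVec : (Submodule.span ℂ (Set.range expVec))ᗮ = ⊥ := by
  rw [Submodule.eq_bot_iff]
  intro g hg
  have hab : -Real.pi < Real.pi := by linarith [Real.pi_pos]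
  have h0 : ∀ j, fourierCoeffOn hab g j = 0 := fun j => by
    rw [← inner_expVec]
    exact (Submodule.mem_orthogonal _ _).1 hg _ (Submodule.subset_span ⟨j, rfl⟩)
  have hpos : (0 : ℝ) < 1 / (2 * Real.pi) := by positivity
  have hmem : MemLp g 2 (volume.restrict (Set.Ioc (-Real.pi) Real.pi)) := by
    refine (Lp.memLp g).of_measure_le_smul (c := (ENNReal.ofReal (1 / (2 * Real.pi)))⁻¹)
      (by simpa using Real.pi_pos) ?_
    rw [momentumMeasure, smul_smul, ENNReal.inv_mul_cancel (by simpa using Real.pi_pos)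
      ENNReal.ofReal_ne_top, one_smul]
    exact Measure.restrict_mono Set.Ioc_subset_Icc_self le_rfl
  have hsum := hasSum_sq_fourierCoeffOn hab hmem
  simp only [h0, norm_zero, ne_eq, OfNat.ofNat_ne_zero, not_false_eq_true, zero_pow] at hsum
  have hzero : (∫ k in (-Real.pi)..Real.pi, ‖g k‖ ^ 2) = 0 := by
    have h := hsum.unique hasSum_zero
    rw [smul_eq_mul, mul_eq_zero] at h
    exact h.resolve_left (inv_ne_zero (by linarith [Real.pi_pos]))
  rw [← inner_self_eq_zero (𝕜 := ℂ), L2.inner_def, integral_momentumMeasure]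
  have hint : (∫ k in (-Real.pi)..Real.pi, inner ℂ (g k) (g k))
      = ((∫ k in (-Real.pi)..Real.pi, ‖g k‖ ^ 2 : ℝ) : ℂ) := by
    rw [← intervalIntegral.integral_ofReal]
    refine intervalIntegral.integral_congr fun k _ => ?_
    simp only [inner_self_eq_norm_sq_to_K]
    push_cast
    rfl
  rw [hint, hzero]
  simp

/-- The Hilbert basis `(e^{ijk})_{j ∈ ℤ}` of `L²[-π, π]`. -/
def expBasis : HilbertBasis ℤ ℂ MomentumSpace :=
  HilbertBasis.mkOfOrthogonalEqBot orthonormal_expVec orthogonal_expVec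

/-- The Fourier transformation `ℓ²(ℤ) ≃ L²[-π, π]`, `f ↦ f̃` with `f̃(k) = ∑_j f_j e^{ijk}`
(convergent in `L²`). -/
def fourierIso : EllTwo ℤ ≃ₗᵢ[ℂ] MomentumSpace := expBasis.repr.symm

/-- The unitary `U_t` on `ℓ²(ℤ)` which in momentum space is multiplication by `e^{itk}`. -/
def shiftUnitary (t : ℝ) : EllTwo ℤ ≃ₗᵢ[ℂ] EllTwo ℤ :=
  (fourierIso.trans (expMul t)).trans fourierIso.symm

/-! ### Flows -/

/-- `c(f) = ∑_j f_j c_j`, linear in `f`. -/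
def cOf (f : EllTwo ℤ) : CAR := ∑' j, f j • c j

/-- `c^*(f) = ∑_j f_j c_j^*`, linear in `f`. -/
def cStarOf (f : EllTwo ℤ) : CAR := ∑' j, f j • star (c j)

/-- A `C^*`-flow on the CAR algebra: a strongly continuous one-parameter group of
automorphisms. -/
structure CStarFlow where
  toFun : ℝ → Aut
  map_zero : toFun 0 = 1
  map_add : ∀ s t, toFun (s + t) = toFun s * toFun t
  continuous_apply : ∀ a : CAR, Continuous fun t => toFun t a

instance : CoeFun CStarFlow (fun _ => ℝ → Aut) := ⟨CStarFlow.toFun⟩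

/-- A strongly continuous one-parameter group of unitaries on `ℓ²(ℤ)`. -/
structure IsUnitaryGroup (U : ℝ → (EllTwo ℤ ≃ₗᵢ[ℂ] EllTwo ℤ)) : Prop where
  map_zero : U 0 = 1
  map_add : ∀ s t, U (s + t) = U s * U t
  continuous_apply : ∀ f : EllTwo ℤ, Continuous fun t => U t f

/-- The flow `τ` is quasi-free, namely the second quantization of `U`: `U` is a strongly
continuous one-parameter unitary group and `τ_t (c^*(f)) = c^*(U_t f)`. -/
structure IsQuasiFree (τ : CStarFlow) (U : ℝ → (EllTwo ℤ ≃ₗᵢ[ℂ] EllTwo ℤ)) : Prop where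
  unitaryGroup : IsUnitaryGroup U
  map_cStarOf : ∀ t f, τ t (cStarOf f) = cStarOf (U t f)

end ShiftFlow

end

open ShiftFlow

/-! The one-particle statement is elementary. Multiplication by `e^{itk}` is a unitary group on
`L²[-π, π]`, strongly continuous because `|k| ≤ π`. Its matrix elements in the basis `e^{ijk}` are
Fourier integrals of `e^{i(j+t-l)k}`, that is `sinc (π(j+t-l))` (`shiftUnitary_single`). At integer
`t` this matrix is the shift.

The substance is to lift a unitary `U` of `ℓ²(ℤ)` to an automorphism of the CAR algebra. The
anticommutation relations give `‖∑ f_j c_j‖² ≤ ∑ |f_j|²`, so `c(f)` and `c^*(f)` converge in norm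
and satisfy smeared relations. Hence the operators `c^*(U e_j)` again obey the relations, and their
adjoints kill the vacuum. Any such system has orthonormal occupation vectors, so there is an
isometry `Γ(U)` of Fock space that fixes the vacuum and carries `c_j^*` to `c^*(U e_j)`. An operator
with these two properties is unique (`clm_ext_vacuum`). Therefore `Γ(UV) = Γ(U)Γ(V)` and `Γ(1) = 1`,
which makes `Γ(U)` unitary. Conjugation by it preserves the CAR algebra and sends `c^*(f)` to `c^*(U
f)`. The group law, the agreement with the discrete shift and strong continuity need to be checked
only on the generators. The formula for `c(f)` has `U_t` and not its complex conjugate because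
`sinc` is real.

Locality fails because for `t ∉ ℤ` every coefficient of `τ_t(c_0)` is non-zero, whereas a strictly
local operator commutes with the number operator `c_l^* c_l` of every site `l` outside its region.
-/

noncomputable section

open MeasureTheory

namespace ShiftFlow

/-! ### Representations of the anticommutation relations with a vacuum vector -/

section FockRepresentation

variable {H : Type*} [NormedAddCommGroup H] [InnerProductSpace ℂ H] [CompleteSpace H]

/-- Operators `d_j` satisfying the canonical anticommutation relations, together with a unit
vector that is annihilated by all of them. -/
structure IsFockRep (d : ℤ → H →L[ℂ] H) (Ω : H) : Prop where
  anticomm : ∀ i j, d i * d j + d j * d i = 0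
  star_anticomm : ∀ i j, star (d i) * d j + d j * star (d i) = if i = j then 1 else 0
  apply_vacuum : ∀ j, d j Ω = 0
  norm_vacuum : ‖Ω‖ = 1

/-- The vector `d_{s₁}^* ⋯ d_{sₙ}^* Ω` for `S = {s₁ < ⋯ < sₙ}`. -/
def occupationVec (d : ℤ → H →L[ℂ] H) (Ω : H) (S : Finset ℤ) : H :=
  (S.sort (· ≤ ·)).foldr (fun j ψ => star (d j) ψ) Ω

theorem occupationVec_empty (d : ℤ → H →L[ℂ] H) (Ω : H) : occupationVec d Ω ∅ = Ω := by
  simp [occupationVec]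

theorem occupationVec_insert (d : ℤ → H →L[ℂ] H) (Ω : H) {a : ℤ} {S : Finset ℤ}
    (h : ∀ x ∈ S, a < x) :
    occupationVec d Ω (insert a S) = star (d a) (occupationVec d Ω S) := by
  rw [occupationVec, Finset.sort_insert _ (fun b hb => (h b hb).le)
    (fun ha => lt_irrefl a (h a ha))]
  rfl

theorem jwSign_of_forall_lt {a : ℤ} {S : Finset ℤ} (h : ∀ x ∈ S, a < x) : jwSign a S = 1 := by
  rw [jwSign, Finset.filter_false_of_mem fun x hx => (h x hx).not_gt]
  simp

namespace IsFockRep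

variable {d : ℤ → H →L[ℂ] H} {Ω : H}

theorem star_star_apply (hd : IsFockRep d Ω) (i j : ℤ) (ψ : H) :
    star (d i) (star (d j) ψ) = -star (d j) (star (d i) ψ) := by
  have h := congrArg star (hd.anticomm j i)
  rw [star_add, star_mul, star_mul, star_zero] at h
  exact eq_neg_of_add_eq_zero_left (by simpa using congrArg (fun T : H →L[ℂ] H => T ψ) h)

theorem apply_star_apply (hd : IsFockRep d Ω) (i j : ℤ) (ψ : H) :
    d j (star (d i) ψ) = (if i = j then ψ else 0) - star (d i) (d j ψ) := by
  have h := congrArg (fun T : H →L[ℂ] H => T ψ) (hd.star_anticomm i j)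
  rw [eq_sub_iff_add_eq, add_comm]
  split_ifs with hij
  · simpa [hij] using h
  · simpa [hij] using h

/-- The creation operators act on the occupation vectors as they do on the basis of Fock
space. -/
theorem star_apply_occupationVec (hd : IsFockRep d Ω) (j : ℤ) (S : Finset ℤ) :
    star (d j) (occupationVec d Ω S)
      = if j ∈ S then 0 else jwSign j S • occupationVec d Ω (insert j S) := by
  -- Each new site `a` lies below all of `S`, so `d_a^*` stands leftmost in the ordered product.
  -- Then `d_j^*` is already in place if `j < a`, squares to zero if `j = a`, and passes `d_a^*` at
  -- the cost of one sign if `j > a`.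
  induction S using Finset.induction_on_min with
  | empty => simp [← occupationVec_insert, jwSign]
  | insert a S ha ih =>
    have haS : a ∉ S := fun h => lt_irrefl a (ha a h)
    rcases lt_trichotomy j a with h | h | h
    · have hlt : ∀ x ∈ insert a S, j < x := by
        intro x hx
        rcases Finset.mem_insert.1 hx with rfl | hx
        · exact h
        · exact h.trans (ha x hx)
      rw [if_neg fun hj => lt_irrefl j (hlt j hj), jwSign_of_forall_lt hlt, one_smul,
        occupationVec_insert d Ω hlt]
    · subst h
      rw [if_pos (Finset.mem_insert_self _ _), occupationVec_insert d Ω ha]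
      have := hd.star_star_apply j j (occupationVec d Ω S)
      rw [eq_neg_iff_add_eq_zero, ← two_smul ℂ] at this
      exact (smul_eq_zero.1 this).resolve_left two_ne_zero
    · rw [occupationVec_insert d Ω ha, hd.star_star_apply, ih]
      by_cases hj : j ∈ S
      · simp [hj]
      · have hlt : ∀ x ∈ insert j S, a < x := by
          intro x hx
          rcases Finset.mem_insert.1 hx with rfl | hx
          · exact h
          · exact ha x hx
        rw [if_neg hj, if_neg (by simp [hj, h.ne']), jwSign_insert haS, if_pos h,
          Finset.insert_comm, occupationVec_insert d Ω hlt, map_smul, neg_smul]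

/-- For `j ∉ S`, `d_j` anticommutes with every creation operator in the product and so reaches the
vacuum, which it kills. -/
theorem apply_occupationVec_of_notMem (hd : IsFockRep d Ω) {j : ℤ} {S : Finset ℤ} (hj : j ∉ S) :
    d j (occupationVec d Ω S) = 0 := by
  induction S using Finset.induction_on_min with
  | empty => rw [occupationVec_empty, hd.apply_vacuum]
  | insert a S ha ih =>
    rw [Finset.mem_insert, not_or] at hj
    rw [occupationVec_insert d Ω ha, hd.apply_star_apply, if_neg (Ne.symm hj.1), ih hj.2]
    simp

theorem apply_occupationVec_insert (hd : IsFockRep d Ω) {j : ℤ} {S : Finset ℤ} (hj : j ∉ S) :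
    d j (occupationVec d Ω (insert j S)) = jwSign j S • occupationVec d Ω S := by
  have h : occupationVec d Ω (insert j S) = jwSign j S • star (d j) (occupationVec d Ω S) := by
    rw [hd.star_apply_occupationVec, if_neg hj, smul_smul, jwSign_mul_self, one_smul]
  rw [h, map_smul, hd.apply_star_apply, if_pos rfl, hd.apply_occupationVec_of_notMem hj]
  simp

/-- The leftmost creation operator of the first vector moves across the inner product as `d_a`. It
kills the second vector unless `a ∈ T`, and otherwise removes `a` from `T`. The resulting sign
matters only when the remaining sets agree, and then it is `1` because `a` lies below all of `S`. -/
theorem inner_occupationVec (hd : IsFockRep d Ω) (S T : Finset ℤ) :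
    inner ℂ (occupationVec d Ω S) (occupationVec d Ω T) = if S = T then 1 else 0 := by
  induction S using Finset.induction_on_min generalizing T with
  | empty =>
    induction T using Finset.induction_on_min with
    | empty => simp [occupationVec_empty, hd.norm_vacuum, inner_self_eq_norm_sq_to_K]
    | insert a T ha _ =>
      rw [occupationVec_insert d Ω ha, occupationVec_empty, ContinuousLinearMap.star_eq_adjoint,
        ContinuousLinearMap.adjoint_inner_right, hd.apply_vacuum, inner_zero_left,
        if_neg (Finset.insert_ne_empty a T).symm]
  | insert a S ha ih =>
    have haS : a ∉ S := fun h => lt_irrefl a (ha a h)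
    rw [occupationVec_insert d Ω ha, ContinuousLinearMap.star_eq_adjoint,
      ContinuousLinearMap.adjoint_inner_left]
    by_cases haT : a ∈ T
    · obtain ⟨T, hT, rfl⟩ : ∃ T', a ∉ T' ∧ T = insert a T' :=
        ⟨T.erase a, by simp, (Finset.insert_erase haT).symm⟩
      rw [hd.apply_occupationVec_insert hT, inner_smul_right, ih]
      by_cases hST : S = T
      · subst hST
        simp [jwSign_of_forall_lt ha]
      · have : insert a S ≠ insert a T := fun h => hST (by
          simpa [Finset.erase_insert haS, Finset.erase_insert hT] using
            congrArg (fun X => Finset.erase X a) h)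
        simp [hST, this]
    · rw [hd.apply_occupationVec_of_notMem haT, inner_zero_right, if_neg]
      rintro rfl
      simp at haT

theorem orthonormal_occupationVec (hd : IsFockRep d Ω) : Orthonormal ℂ (occupationVec d Ω) :=
  orthonormal_iff_ite.2 hd.inner_occupationVec

/-- The isometry of Fock space that sends the basis vectors to the occupation vectors. -/
def fockIsometry (hd : IsFockRep d Ω) : Fock →ₗᵢ[ℂ] H :=
  hd.orthonormal_occupationVec.orthogonalFamily.linearIsometry

theorem fockIsometry_single (hd : IsFockRep d Ω) (S : Finset ℤ) :
    hd.fockIsometry (lp.single 2 S (1 : ℂ)) = occupationVec d Ω S := by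
  rw [fockIsometry, OrthogonalFamily.linearIsometry_apply_single]
  simp

end IsFockRep

/-- The vacuum vector of Fock space. -/
def vacuum : Fock := lp.single 2 ∅ (1 : ℂ)

theorem annihilation_vacuum (j : ℤ) : annihilation j vacuum = 0 := by
  ext S
  rw [annihilation_apply, annihilationFun]
  by_cases h : j ∈ S <;> simp [h, vacuum, lp.single_apply]

theorem star_annihilation_single (j : ℤ) (S : Finset ℤ) :
    star (annihilation j) (lp.single 2 S (1 : ℂ) : Fock)
      = if j ∈ S then 0 else jwSign j S • (lp.single 2 (insert j S) (1 : ℂ) : Fock) := by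
  ext T
  rw [star_annihilation_apply]
  by_cases hT : j ∈ T
  · by_cases hS : j ∈ S
    · have : T.erase j ≠ S := by rintro rfl; simp at hS
      simp [hT, hS, lp.single_apply, this]
    · by_cases hE : T.erase j = S
      · subst hE
        simp [hT, lp.single_apply, Finset.insert_erase]
      · have : T ≠ insert j S := by rintro rfl; exact hE (Finset.erase_insert hS)
        simp [hT, hS, lp.single_apply, hE, this]
  · by_cases hS : j ∈ S
    · simp [hT, hS]
    · have : T ≠ insert j S := by rintro rfl; simp at hT
      simp [hT, hS, lp.single_apply, this]

/-- Bounded operators on Fock space are determined by their values on the basis. -/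
theorem clm_ext_single {E : Type*} [NormedAddCommGroup E] [NormedSpace ℂ E]
    {A B : Fock →L[ℂ] E}
    (h : ∀ S : Finset ℤ, A (lp.single 2 S (1 : ℂ)) = B (lp.single 2 S (1 : ℂ))) : A = B := by
  ext ψ
  have hs : ∀ S : Finset ℤ, (lp.single 2 S (ψ S) : Fock) = ψ S • lp.single 2 S (1 : ℂ) := by
    intro S
    rw [← lp.single_smul, smul_eq_mul, mul_one]
  have hψ := lp.hasSum_single (p := 2) (by simp) ψ
  refine (A.hasSum hψ).unique ?_
  convert B.hasSum hψ using 2 with S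
  rw [hs, map_smul, map_smul, h]

/-- Bounded operators on Fock space that intertwine creation operators are determined by their
value on the vacuum. -/
theorem clm_ext_vacuum {d : ℤ → H →L[ℂ] H} {A B : Fock →L[ℂ] H}
    (hA : ∀ j ψ, A (star (annihilation j) ψ) = star (d j) (A ψ))
    (hB : ∀ j ψ, B (star (annihilation j) ψ) = star (d j) (B ψ))
    (h : A vacuum = B vacuum) : A = B := by
  refine clm_ext_single fun S => ?_
  induction S using Finset.induction_on_min with
  | empty => exact h
  | insert a S ha ih =>
    have haS : a ∉ S := fun h => lt_irrefl a (ha a h)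
    have hs : (lp.single 2 (insert a S) (1 : ℂ) : Fock)
        = star (annihilation a) (lp.single 2 S (1 : ℂ)) := by
      rw [star_annihilation_single, if_neg haS, jwSign_of_forall_lt ha, one_smul]
    rw [hs, hA, hB, ih]

theorem IsFockRep.fockIsometry_vacuum {d : ℤ → H →L[ℂ] H} {Ω : H} (hd : IsFockRep d Ω) :
    hd.fockIsometry vacuum = Ω := by
  rw [vacuum, hd.fockIsometry_single, occupationVec_empty]

/-- Creation operators act on the basis of Fock space and on the occupation vectors by the same
formula, signs included. -/
theorem IsFockRep.fockIsometry_star {d : ℤ → H →L[ℂ] H} {Ω : H} (hd : IsFockRep d Ω) (j : ℤ)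
    (ψ : Fock) : hd.fockIsometry (star (annihilation j) ψ) = star (d j) (hd.fockIsometry ψ) := by
  have : hd.fockIsometry.toContinuousLinearMap ∘L star (annihilation j)
      = star (d j) ∘L hd.fockIsometry.toContinuousLinearMap := by
    refine clm_ext_single fun S => ?_
    simp only [ContinuousLinearMap.comp_apply, LinearIsometry.coe_toContinuousLinearMap,
      star_annihilation_single, hd.fockIsometry_single, hd.star_apply_occupationVec]
    split_ifs with h
    · exact map_zero _
    · rw [map_smul, hd.fockIsometry_single]
  exact congrArg (fun T : Fock →L[ℂ] H => T ψ) this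

end FockRepresentation

/-! ### The smeared operators `c(f)` and `c^*(f)` -/

instance : CompleteSpace CAR :=
  (StarSubalgebra.isClosed_topologicalClosure
    (StarAlgebra.adjoin ℂ (Set.range annihilation))).completeSpace_coe

/-- Taking the expectation in `ψ` gives `‖aψ‖² + ‖a^*ψ‖² = r‖ψ‖²`; the second term is dropped. -/
theorem norm_sq_le_of_anticomm {H : Type*} [NormedAddCommGroup H] [InnerProductSpace ℂ H]
    [CompleteSpace H] {a : H →L[ℂ] H} {r : ℝ} (hr : 0 ≤ r)
    (h : star a * a + a * star a = (r : ℂ) • (1 : H →L[ℂ] H)) : ‖a‖ ^ 2 ≤ r := by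
  have hle : ‖a‖ ≤ √r := by
    refine a.opNorm_le_bound (Real.sqrt_nonneg r) fun ψ => ?_
    have h1 := congrArg (fun T : H →L[ℂ] H => RCLike.re (inner ℂ ψ (T ψ))) h
    change RCLike.re (inner ℂ ψ (star a (a ψ) + a (star a ψ)))
      = RCLike.re (inner ℂ ψ ((r : ℂ) • ψ)) at h1
    rw [inner_add_right, inner_smul_right, map_add] at h1
    have h2 : inner ℂ ψ (star a (a ψ)) = ((‖a ψ‖ ^ 2 : ℝ) : ℂ) := by
      rw [ContinuousLinearMap.star_eq_adjoint, ContinuousLinearMap.adjoint_inner_right,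
        inner_self_eq_norm_sq_to_K]
      simp
    have h3 : inner ℂ ψ (a (star a ψ)) = ((‖star a ψ‖ ^ 2 : ℝ) : ℂ) := by
      rw [← ContinuousLinearMap.adjoint_inner_left, ← ContinuousLinearMap.star_eq_adjoint,
        inner_self_eq_norm_sq_to_K]
      simp
    have h4 : (r : ℂ) * inner ℂ ψ ψ = ((r * ‖ψ‖ ^ 2 : ℝ) : ℂ) := by
      rw [inner_self_eq_norm_sq_to_K]
      simp
    rw [h2, h3, h4] at h1
    simp only [RCLike.re_to_complex, Complex.ofReal_re] at h1
    refine abs_le_of_sq_le_sq' ?_ (by positivity) |>.2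
    rw [mul_pow, Real.sq_sqrt hr]
    nlinarith [sq_nonneg ‖star a ψ‖]
  calc ‖a‖ ^ 2 ≤ √r ^ 2 := by gcongr
    _ = r := Real.sq_sqrt hr

theorem anticomm_sum_smul_c (f : ℤ → ℂ) (s : Finset ℤ) :
    star (∑ j ∈ s, f j • c j) * (∑ j ∈ s, f j • c j)
      + (∑ j ∈ s, f j • c j) * star (∑ j ∈ s, f j • c j)
      = ((∑ j ∈ s, ‖f j‖ ^ 2 : ℝ) : ℂ) • (1 : CAR) := by
  rw [star_sum, Finset.sum_mul_sum, Finset.sum_mul_sum,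
    -- The swap makes the index of the starred factor the outer one in both double sums, so that
    -- they combine term by term into anticommutators.
    Finset.sum_comm (f := fun i j => f i • c i * star (f j • c j)), ← Finset.sum_add_distrib,
    Complex.ofReal_sum, Finset.sum_smul]
  refine Finset.sum_congr rfl fun i hi => ?_
  rw [← Finset.sum_add_distrib]
  have h : ∀ j, star (f i • c i) * (f j • c j) + f j • c j * star (f i • c i)
      = if i = j then (((‖f i‖ ^ 2 : ℝ)) : ℂ) • (1 : CAR) else 0 := by
    intro j
    rw [star_smul, smul_mul_smul_comm, smul_mul_smul_comm, mul_comm (f j), ← smul_add,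
      c_star_anticomm]
    split_ifs with hij
    · subst hij
      rw [RCLike.star_def, RCLike.conj_mul]
      simp
    · rw [smul_zero]
  simp only [h, Finset.sum_ite_eq, if_pos hi]

/-- This is the `ℓ²` bound behind every norm-convergent sum below: tails of a square-summable family
give small operators, although `∑ |f_j|` may diverge. -/
theorem norm_sum_smul_c_sq_le (f : ℤ → ℂ) (s : Finset ℤ) :
    ‖∑ j ∈ s, f j • c j‖ ^ 2 ≤ ∑ j ∈ s, ‖f j‖ ^ 2 :=
  norm_sq_le_of_anticomm (a := ((∑ j ∈ s, f j • c j : CAR) : Fock →L[ℂ] Fock))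
    (Finset.sum_nonneg fun _ _ => sq_nonneg _)
    (congrArg (Subtype.val : CAR → Fock →L[ℂ] Fock) (anticomm_sum_smul_c f s))

theorem hasSum_norm_sq (f : EllTwo ℤ) : HasSum (fun j => ‖f j‖ ^ 2) (‖f‖ ^ 2) := by
  simpa using lp.hasSum_norm (p := 2) (by simp) f

theorem summable_smul_c (f : EllTwo ℤ) : Summable fun j => f j • c j := by
  rw [summable_iff_vanishing_norm]
  intro ε hε
  obtain ⟨s, hs⟩ := summable_iff_vanishing_norm.1 (hasSum_norm_sq f).summable (ε ^ 2)
    (by positivity)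
  refine ⟨s, fun t ht => ?_⟩
  have h1 := hs t ht
  rw [Real.norm_of_nonneg (Finset.sum_nonneg fun _ _ => sq_nonneg _)] at h1
  exact lt_of_pow_lt_pow_left₀ 2 hε.le ((norm_sum_smul_c_sq_le f t).trans_lt h1)

theorem hasSum_cOf (f : EllTwo ℤ) : HasSum (fun j => f j • c j) (cOf f) :=
  (summable_smul_c f).hasSum

theorem hasSum_star_cOf_star (f : EllTwo ℤ) :
    HasSum (fun j => f j • star (c j)) (star (cOf (star f))) := by
  convert (hasSum_cOf (star f)).star using 2 with j
  rw [star_smul, lp.star_apply, star_star]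

/-- Both `c` and `c^*` are linear in `f`, so passing between them by the adjoint conjugates the
coefficients. This transfers the estimates for `c(f)` to `c^*(f)`. -/
theorem cStarOf_eq (f : EllTwo ℤ) : cStarOf f = star (cOf (star f)) :=
  (hasSum_star_cOf_star f).tsum_eq

theorem hasSum_cStarOf (f : EllTwo ℤ) : HasSum (fun j => f j • star (c j)) (cStarOf f) := by
  rw [cStarOf_eq]
  exact hasSum_star_cOf_star f

theorem star_cStarOf (f : EllTwo ℤ) : star (cStarOf f) = cOf (star f) := by
  rw [cStarOf_eq, star_star]

theorem norm_cOf_le (f : EllTwo ℤ) : ‖cOf f‖ ≤ ‖f‖ := by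
  refine le_of_tendsto (hasSum_cOf f).norm (Filter.Eventually.of_forall fun s => ?_)
  refine abs_le_of_sq_le_sq' ?_ (norm_nonneg _) |>.2
  exact (norm_sum_smul_c_sq_le f s).trans
    (sum_le_hasSum s (fun _ _ => sq_nonneg _) (hasSum_norm_sq f))

/-- `f ↦ c(f)` as a bounded linear map. -/
def cOfCLM : EllTwo ℤ →L[ℂ] CAR :=
  LinearMap.mkContinuous
    { toFun := cOf
      map_add' := fun f g => by
        refine (hasSum_cOf (f + g)).unique ?_
        convert (hasSum_cOf f).add (hasSum_cOf g) using 2 with j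
        rw [lp.coeFn_add, Pi.add_apply, add_smul]
      map_smul' := fun z f => by
        rw [RingHom.id_apply]
        refine (hasSum_cOf (z • f)).unique ?_
        convert (hasSum_cOf f).const_smul z using 2 with j
        rw [lp.coeFn_smul, Pi.smul_apply, smul_assoc] }
    1 fun f => by rw [one_mul]; exact norm_cOf_le f

theorem continuous_cOf : Continuous cOf := cOfCLM.continuous

theorem continuous_cStarOf : Continuous cStarOf := by
  simp only [funext cStarOf_eq]
  exact (continuous_cOf.comp continuous_star).star

theorem cStarOf_single (j : ℤ) : cStarOf (lp.single 2 j (1 : ℂ)) = star (c j) := by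
  refine (hasSum_cStarOf _).unique ?_
  convert hasSum_single j ?_ using 1
  · simp
  · intro i hi
    simp [lp.single_apply, hi]

theorem hasSum_smul_single (f : EllTwo ℤ) :
    HasSum (fun j => f j • (lp.single 2 j (1 : ℂ) : EllTwo ℤ)) f := by
  convert lp.hasSum_single (p := 2) (by simp) f using 2 with j
  rw [← lp.single_smul, smul_eq_mul, mul_one]

/-! ### Anticommutation relations of the smeared operators -/

theorem hasSum_cStarOf_anticomm (f : EllTwo ℤ) (x : CAR) :
    HasSum (fun j => f j • (star (c j) * x + x * star (c j)))
      (cStarOf f * x + x * cStarOf f) := by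
  simpa only [smul_mul_assoc, mul_smul_comm, ← smul_add] using
    ((hasSum_cStarOf f).mul_right x).add ((hasSum_cStarOf f).mul_left x)

theorem star_c_anticomm (i j : ℤ) : star (c i) * star (c j) + star (c j) * star (c i) = 0 := by
  rw [← star_mul, ← star_mul, ← star_add, c_anticomm, star_zero]

theorem cStarOf_anticomm (f g : EllTwo ℤ) :
    cStarOf f * cStarOf g + cStarOf g * cStarOf f = 0 := by
  have h : ∀ j, star (c j) * cStarOf g + cStarOf g * star (c j) = 0 := by
    intro j
    rw [add_comm]
    refine (hasSum_cStarOf_anticomm g _).unique ?_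
    simp only [star_c_anticomm, smul_zero]
    exact hasSum_zero
  refine (hasSum_cStarOf_anticomm f _).unique ?_
  simp only [h, smul_zero]
  exact hasSum_zero

theorem cStarOf_anticomm_c (f : EllTwo ℤ) (j : ℤ) :
    cStarOf f * c j + c j * cStarOf f = f j • 1 := by
  refine (hasSum_cStarOf_anticomm f _).unique ?_
  simp only [c_star_anticomm]
  convert hasSum_single j ?_ using 1
  · simp
  · intro i hi
    simp [hi]

/-- The sum over `g` is collapsed first, by the relation with a single `c_j`. What remains is the
series of the inner product, conjugate-linear in `g`. -/
theorem cStarOf_anticomm_star (f g : EllTwo ℤ) :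
    cStarOf f * star (cStarOf g) + star (cStarOf g) * cStarOf f = inner ℂ g f • 1 := by
  refine (hasSum_cStarOf_anticomm f _).unique ?_
  have h : ∀ j, star (c j) * star (cStarOf g) + star (cStarOf g) * star (c j)
      = star (g j) • 1 := by
    intro j
    rw [← star_mul, ← star_mul, ← star_add, cStarOf_anticomm_c, star_smul, star_one]
  simp only [h, smul_smul]
  exact (lp.hasSum_inner g f).smul_const 1

/-! ### The one-particle group -/

theorem integral_expFun (s : ℝ) :
    ∫ k in (-Real.pi)..Real.pi, expFun s k
      = 2 * Real.pi * ((Real.sinc (Real.pi * s) : ℝ) : ℂ) := by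
  by_cases hs : s = 0
  · subst hs
    simp only [expFun_zero, intervalIntegral.integral_const, mul_zero, Real.sinc_zero]
    rw [sub_neg_eq_add, ← two_mul, Complex.real_smul]
    push_cast
    ring
  · have h := intervalIntegral.integral_comp_mul_left (a := -Real.pi) (b := Real.pi)
      (fun x : ℝ => Complex.exp (x * Complex.I)) hs
    have h1 : s * -Real.pi = -(Real.pi * s) := by ring
    rw [h1, mul_comm s Real.pi, integral_exp_mul_I_eq_sinc] at h
    have h2 : ∀ k : ℝ, Complex.exp (((s * k : ℝ) : ℂ) * Complex.I) = expFun s k := by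
      intro k
      simp [expFun]
    simp only [h2] at h
    rw [h, Complex.real_smul]
    have : (s : ℂ) ≠ 0 := by exact_mod_cast hs
    push_cast
    field_simp

theorem fourierIso_single (j : ℤ) : fourierIso (lp.single 2 j (1 : ℂ)) = expVec j := by
  rw [fourierIso, HilbertBasis.repr_symm_single, expBasis, HilbertBasis.coe_mkOfOrthogonalEqBot]

theorem fourierIso_symm_apply (g : MomentumSpace) (l : ℤ) :
    fourierIso.symm g l = inner ℂ (expVec l) g := by
  rw [fourierIso, LinearIsometryEquiv.symm_symm, HilbertBasis.repr_apply_apply, expBasis,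
    HilbertBasis.coe_mkOfOrthogonalEqBot]

theorem coeFn_expMul (t : ℝ) (g : MomentumSpace) :
    expMul t g =ᵐ[momentumMeasure] fun k => expFun t k * g k :=
  coeFn_expMulLin t g

/-- The matrix elements of `U_t` are given by the cardinal sine. -/
theorem shiftUnitary_single (t : ℝ) (j l : ℤ) :
    shiftUnitary t (lp.single 2 j (1 : ℂ)) l
      = ((Real.sinc (Real.pi * (j + t - l)) : ℝ) : ℂ) := by
  change fourierIso.symm (expMul t (fourierIso (lp.single 2 j (1 : ℂ)))) l = _
  rw [fourierIso_single, fourierIso_symm_apply, L2.inner_def]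
  have h : ∫ k, inner ℂ (expVec l k) (expMul t (expVec j) k) ∂momentumMeasure
      = ∫ k, expFun (j + t - l) k ∂momentumMeasure := by
    refine integral_congr_ae ?_
    filter_upwards [MemLp.coeFn_toLp (memLp_expFun l), MemLp.coeFn_toLp (memLp_expFun j),
      coeFn_expMul t (expVec j)] with k hl hj ht
    have hc : (starRingEnd ℂ) (expFun l k) = expFun (-l) k := by
      simp [expFun, ← Complex.exp_conj]
    rw [ht, expVec, expVec, hl, hj, RCLike.inner_apply, hc, expFun_mul, expFun_mul]
    congr 1
    ring
  rw [h, integral_momentumMeasure, integral_expFun, Complex.real_smul]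
  have : (Real.pi : ℂ) ≠ 0 := by exact_mod_cast Real.pi_ne_zero
  push_cast
  field_simp

/-- At integer times the argument of `sinc` is a multiple of `π`, where `sinc` vanishes except at
`0`. -/
theorem shiftUnitary_intCast_single (i j : ℤ) :
    shiftUnitary i (lp.single 2 j (1 : ℂ)) = lp.single 2 (j + i) (1 : ℂ) := by
  ext l
  rw [shiftUnitary_single]
  by_cases h : l = j + i
  · subst h
    simp
  · have hne : Real.pi * ((j : ℝ) + i - l) ≠ 0 := by
      refine mul_ne_zero Real.pi_ne_zero ?_
      rw [sub_ne_zero]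
      exact_mod_cast Ne.symm h
    have hsin : Real.sin (Real.pi * ((j : ℝ) + i - l)) = 0 := by
      rw [mul_comm]
      exact_mod_cast Real.sin_int_mul_pi (j + i - l)
    rw [Real.sinc_of_ne_zero hne, hsin]
    simp [lp.single_apply, h]

theorem expMul_zero : expMul 0 = 1 := by
  ext1 g
  refine Lp.ext ?_
  filter_upwards [coeFn_expMul 0 g] with k hk
  rw [hk, expFun_zero, one_mul]
  rfl

theorem expMul_add (s t : ℝ) : expMul (s + t) = expMul s * expMul t := by
  ext1 g
  refine Lp.ext ?_
  filter_upwards [coeFn_expMul (s + t) g, coeFn_expMul s (expMul t g), coeFn_expMul t g]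
    with k h1 h2 h3
  change _ = expMul s (expMul t g) k
  rw [h1, h2, h3, ← mul_assoc, expFun_mul]

theorem norm_expFun_sub_le (s t k : ℝ) : ‖expFun s k - expFun t k‖ ≤ |s - t| * |k| := by
  have h : expFun s k - expFun t k
      = expFun t k * (Complex.exp (Complex.I * (((s - t) * k : ℝ) : ℂ)) - 1) := by
    have : Complex.exp (Complex.I * (((s - t) * k : ℝ) : ℂ)) = expFun (s - t) k := by
      rw [expFun, mul_comm]
      push_cast
      rfl
    rw [this, mul_sub, expFun_mul, mul_one, add_sub_cancel]
  rw [h, norm_mul, norm_expFun, one_mul, ← abs_mul]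
  exact Real.norm_exp_I_mul_ofReal_sub_one_le

theorem ae_abs_le_pi : ∀ᵐ k ∂momentumMeasure, |k| ≤ Real.pi := by
  refine Measure.ae_smul_measure ?_ _
  filter_upwards [ae_restrict_mem measurableSet_Icc] with k hk
  exact abs_le.2 hk

/-- The factor `π` bounds the momentum: since `|k| ≤ π`, the generator of the group is bounded and
every orbit is Lipschitz in time. -/
theorem norm_expMul_sub_le (s t : ℝ) (g : MomentumSpace) :
    ‖expMul s g - expMul t g‖ ≤ |s - t| * Real.pi * ‖g‖ := by
  refine Lp.norm_le_mul_norm_of_ae_le_mul ?_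
  filter_upwards [Lp.coeFn_sub (expMul s g) (expMul t g), coeFn_expMul s g, coeFn_expMul t g,
    ae_abs_le_pi] with k h1 h2 h3 h4
  rw [h1, Pi.sub_apply, h2, h3, ← sub_mul, norm_mul]
  gcongr
  exact (norm_expFun_sub_le s t k).trans (by gcongr)

theorem continuous_expMul_apply (g : MomentumSpace) : Continuous fun t => expMul t g := by
  refine (LipschitzWith.of_dist_le_mul (K := ⟨Real.pi * ‖g‖, by positivity⟩)
    fun s t => ?_).continuous
  rw [dist_eq_norm, Real.dist_eq]
  refine (norm_expMul_sub_le s t g).trans (le_of_eq ?_)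
  change _ = Real.pi * ‖g‖ * _
  ring

theorem isUnitaryGroup_shiftUnitary : IsUnitaryGroup shiftUnitary where
  map_zero := by
    ext1 f
    change fourierIso.symm (expMul 0 (fourierIso f)) = f
    rw [expMul_zero]
    exact fourierIso.symm_apply_apply f
  map_add := fun s t => by
    ext1 f
    change fourierIso.symm (expMul (s + t) (fourierIso f))
      = fourierIso.symm (expMul s (fourierIso (fourierIso.symm (expMul t (fourierIso f)))))
    rw [expMul_add, fourierIso.apply_symm_apply]
    rfl
  continuous_apply := fun f =>
    fourierIso.symm.continuous.comp (continuous_expMul_apply (fourierIso f))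

theorem sinc_eq_of_notMem_range {t : ℝ} (ht : t ∉ Set.range ((↑) : ℤ → ℝ)) (j l : ℤ) :
    Real.sinc (Real.pi * (j + t - l))
      = (-1 : ℝ) ^ (j - l) * Real.sin (Real.pi * t) / (Real.pi * (j + t - l)) := by
  have hne : (j : ℝ) + t - l ≠ 0 := fun h => ht ⟨l - j, by push_cast; linarith⟩
  rw [Real.sinc_of_ne_zero (mul_ne_zero Real.pi_ne_zero hne), ← Real.sin_add_int_mul_pi]
  congr 2
  push_cast
  ring

/-- The numerator is `± sin (πt)`, which vanishes only at integers. This is what spreads `τ_t(c_j)`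
over all sites. -/
theorem sinc_ne_zero_of_notMem_range {t : ℝ} (ht : t ∉ Set.range ((↑) : ℤ → ℝ)) (j l : ℤ) :
    Real.sinc (Real.pi * (j + t - l)) ≠ 0 := by
  have hne : (j : ℝ) + t - l ≠ 0 := fun h => ht ⟨l - j, by push_cast; linarith⟩
  rw [sinc_eq_of_notMem_range ht]
  refine div_ne_zero (mul_ne_zero (zpow_ne_zero _ (by norm_num)) ?_)
    (mul_ne_zero Real.pi_ne_zero hne)
  intro h
  obtain ⟨n, hn⟩ := Real.sin_eq_zero_iff.1 h
  exact ht ⟨n, mul_right_cancel₀ Real.pi_ne_zero (hn.trans (mul_comm _ _))⟩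

/-! ### Second quantization -/

theorem cOf_vacuum (f : EllTwo ℤ) : (cOf f : Fock →L[ℂ] Fock) vacuum = 0 := by
  have h1 : HasSum (fun j => f j • annihilation j) (cOf f : Fock →L[ℂ] Fock) :=
    (hasSum_cOf f).map carStarSubalgebra.subtype continuous_subtype_val
  have h2 := h1.mapL (ContinuousLinearMap.apply ℂ Fock vacuum)
  refine h2.unique ?_
  convert hasSum_zero with j
  change f j • annihilation j vacuum = 0
  rw [annihilation_vacuum, smul_zero]

theorem norm_vacuum : ‖vacuum‖ = 1 := by
  rw [vacuum, lp.norm_single (by simp), norm_one]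

/-- The transformed creation operators `c^*(U e_j)` again form a Fock representation. -/
theorem isFockRep_cStarOf (U : EllTwo ℤ ≃ₗᵢ[ℂ] EllTwo ℤ) :
    -- The family consists of annihilators, hence the adjoint: `d_j^*` is then `c^*(U e_j)`, while
    -- `d_j` is `c` of the conjugated vector and kills the vacuum.
    IsFockRep (fun j => ((star (cStarOf (U (lp.single 2 j (1 : ℂ)))) : CAR) : Fock →L[ℂ] Fock))
      vacuum where
  anticomm := fun i j => by
    have h := congrArg star (cStarOf_anticomm (U (lp.single 2 j 1)) (U (lp.single 2 i 1)))
    rw [star_add, star_mul, star_mul, star_zero] at h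
    exact congrArg (Subtype.val : CAR → Fock →L[ℂ] Fock) h
  star_anticomm := fun i j => by
    have h := cStarOf_anticomm_star (U (lp.single 2 i 1)) (U (lp.single 2 j 1))
    have hi : inner ℂ (lp.single 2 j (1 : ℂ) : EllTwo ℤ) (lp.single 2 i (1 : ℂ))
        = if i = j then 1 else 0 := by
      rw [lp.inner_single_left]
      by_cases hij : i = j
      · subst hij
        simp
      · simp [hij, lp.single_apply, Ne.symm hij]
    rw [LinearIsometryEquiv.inner_map_map, hi] at h
    have h' := congrArg (Subtype.val : CAR → Fock →L[ℂ] Fock) h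
    rw [← StarMemClass.coe_star, star_star]
    refine h'.trans ?_
    split_ifs
    · rw [one_smul]; rfl
    · rw [zero_smul]; rfl
  apply_vacuum := fun j => by
    rw [star_cStarOf]
    exact cOf_vacuum _
  norm_vacuum := norm_vacuum

/-- The isometry `Γ(U)` of Fock space. -/
def fockMap (U : EllTwo ℤ ≃ₗᵢ[ℂ] EllTwo ℤ) : Fock →ₗᵢ[ℂ] Fock :=
  (isFockRep_cStarOf U).fockIsometry

theorem fockMap_vacuum (U : EllTwo ℤ ≃ₗᵢ[ℂ] EllTwo ℤ) : fockMap U vacuum = vacuum :=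
  (isFockRep_cStarOf U).fockIsometry_vacuum

theorem fockMap_star_annihilation (U : EllTwo ℤ ≃ₗᵢ[ℂ] EllTwo ℤ) (j : ℤ) (ψ : Fock) :
    fockMap U (star (annihilation j) ψ)
      = (cStarOf (U (lp.single 2 j (1 : ℂ))) : Fock →L[ℂ] Fock) (fockMap U ψ) := by
  have h := (isFockRep_cStarOf U).fockIsometry_star j ψ
  rwa [← StarMemClass.coe_star, star_star] at h

theorem hasSum_cStarOf_apply (f : EllTwo ℤ) (ψ : Fock) :
    HasSum (fun j => f j • star (annihilation j) ψ) ((cStarOf f : Fock →L[ℂ] Fock) ψ) := by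
  have h1 : HasSum (fun j => f j • star (annihilation j)) (cStarOf f : Fock →L[ℂ] Fock) :=
    (hasSum_cStarOf f).map carStarSubalgebra.subtype continuous_subtype_val
  exact h1.mapL (ContinuousLinearMap.apply ℂ Fock ψ)

theorem hasSum_smul_cStarOf (U : EllTwo ℤ ≃ₗᵢ[ℂ] EllTwo ℤ) (f : EllTwo ℤ) :
    HasSum (fun j => f j • cStarOf (U (lp.single 2 j (1 : ℂ)))) (cStarOf (U f)) := by
  -- The expansion of `U f` is pushed through the bounded linear map `f ↦ c(f)`, with conjugation
  -- before and after to turn it into `c^*`.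
  have h := ((hasSum_smul_single f).mapL (U : EllTwo ℤ →L[ℂ] EllTwo ℤ)).star.mapL cOfCLM |>.star
  simp only [map_smul, star_smul, star_star] at h
  simp only [cStarOf_eq]
  exact h

theorem hasSum_smul_cOf (U : EllTwo ℤ ≃ₗᵢ[ℂ] EllTwo ℤ) (f : EllTwo ℤ) :
    HasSum (fun j => f j • cOf (U (lp.single 2 j (1 : ℂ)))) (cOf (U f)) := by
  have h := ((hasSum_smul_single f).mapL (U : EllTwo ℤ →L[ℂ] EllTwo ℤ)).mapL cOfCLM
  simp only [map_smul] at h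
  exact h

theorem fockMap_cStarOf (U : EllTwo ℤ ≃ₗᵢ[ℂ] EllTwo ℤ) (f : EllTwo ℤ) (ψ : Fock) :
    fockMap U ((cStarOf f : Fock →L[ℂ] Fock) ψ)
      = (cStarOf (U f) : Fock →L[ℂ] Fock) (fockMap U ψ) := by
  have h1 := (hasSum_cStarOf_apply f ψ).mapL (fockMap U).toContinuousLinearMap
  have h2 : HasSum (fun j => f j • (cStarOf (U (lp.single 2 j (1 : ℂ))) : Fock →L[ℂ] Fock))
      (cStarOf (U f) : Fock →L[ℂ] Fock) :=
    (hasSum_smul_cStarOf U f).map carStarSubalgebra.subtype continuous_subtype_val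
  have h3 := h2.mapL (ContinuousLinearMap.apply ℂ Fock (fockMap U ψ))
  refine h1.unique ?_
  simp only [map_smul, LinearIsometry.coe_toContinuousLinearMap, fockMap_star_annihilation]
  exact h3

/-- Both sides fix the vacuum and carry `c_j^*` to `c^*(UV e_j)`, which determines them. Applied to
`U` and `U⁻¹`, this gives surjectivity of `Γ(U)` without showing separately that the occupation
vectors are complete. -/
theorem fockMap_mul_apply (U V : EllTwo ℤ ≃ₗᵢ[ℂ] EllTwo ℤ) (ψ : Fock) :
    fockMap (U * V) ψ = fockMap U (fockMap V ψ) := by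
  have h : (fockMap (U * V)).toContinuousLinearMap
      = (fockMap U).toContinuousLinearMap ∘L (fockMap V).toContinuousLinearMap := by
    refine clm_ext_vacuum (d := fun j =>
      ((star (cStarOf ((U * V) (lp.single 2 j (1 : ℂ)))) : CAR) : Fock →L[ℂ] Fock)) ?_ ?_ ?_
    · exact (isFockRep_cStarOf (U * V)).fockIsometry_star
    · intro j φ
      rw [← StarMemClass.coe_star, star_star]
      change fockMap U (fockMap V (star (annihilation j) φ))
        = (cStarOf (U (V (lp.single 2 j (1 : ℂ)))) : Fock →L[ℂ] Fock) (fockMap U (fockMap V φ))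
      rw [fockMap_star_annihilation, fockMap_cStarOf]
    · change fockMap (U * V) vacuum = fockMap U (fockMap V vacuum)
      simp only [fockMap_vacuum]
  exact congrArg (fun T : Fock →L[ℂ] Fock => T ψ) h

theorem fockMap_one_apply (ψ : Fock) : fockMap 1 ψ = ψ := by
  have h : (fockMap 1).toContinuousLinearMap = ContinuousLinearMap.id ℂ Fock := by
    refine clm_ext_vacuum (d := annihilation) ?_ (fun _ _ => rfl) (fockMap_vacuum 1)
    intro j φ
    have := fockMap_star_annihilation 1 j φ
    rw [LinearIsometryEquiv.coe_one, id, cStarOf_single] at this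
    exact this
  exact congrArg (fun T : Fock →L[ℂ] Fock => T ψ) h

/-- The second quantization `Γ(U)` of a unitary, as a unitary on Fock space. -/
def fockUnitary (U : EllTwo ℤ ≃ₗᵢ[ℂ] EllTwo ℤ) : Fock ≃ₗᵢ[ℂ] Fock where
  toLinearEquiv := LinearEquiv.ofLinearMap (fockMap U).toLinearMap (fockMap U⁻¹).toLinearMap
    (by
      ext1 ψ
      change fockMap U (fockMap U⁻¹ ψ) = ψ
      rw [← fockMap_mul_apply, mul_inv_cancel, fockMap_one_apply])
    (by
      ext1 ψ
      change fockMap U⁻¹ (fockMap U ψ) = ψ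
      rw [← fockMap_mul_apply, inv_mul_cancel, fockMap_one_apply])
  norm_map' := (fockMap U).norm_map

theorem conj_fockUnitary_cStarOf (U : EllTwo ℤ ≃ₗᵢ[ℂ] EllTwo ℤ) (f : EllTwo ℤ) :
    (fockUnitary U).conjStarAlgEquiv (cStarOf f : Fock →L[ℂ] Fock) = cStarOf (U f) := by
  ext1 ψ
  change fockMap U ((cStarOf f : Fock →L[ℂ] Fock) (fockMap U⁻¹ ψ)) = _
  rw [fockMap_cStarOf, ← fockMap_mul_apply, mul_inv_cancel, fockMap_one_apply]

/-- The closed `*`-subalgebra generated by the `c_j` is the whole CAR algebra. -/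
theorem mem_of_isClosed {S : StarSubalgebra ℂ CAR} (hS : IsClosed (S : Set CAR))
    (hc : ∀ j, c j ∈ S) (a : CAR) : a ∈ S := by
  have hle : carStarSubalgebra ≤ S.map carStarSubalgebra.subtype := by
    refine StarSubalgebra.topologicalClosure_minimal (StarAlgebra.adjoin_le ?_) ?_
    · rintro _ ⟨j, rfl⟩
      exact ⟨c j, hc j, rfl⟩
    -- The CAR algebra is closed among the bounded operators, so a closed subset of it is closed
    -- there too.
    · exact (StarSubalgebra.isClosed_topologicalClosure _).isClosedEmbedding_subtypeVal.isClosedMap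
        _ hS
  obtain ⟨b, hb, hba⟩ := hle a.2
  rwa [← Subtype.ext hba]

theorem conj_mem {e : Fock ≃ₗᵢ[ℂ] Fock}
    (he : ∀ j, e.conjStarAlgEquiv (annihilation j) ∈ carStarSubalgebra) (a : CAR) :
    e.conjStarAlgEquiv (a : Fock →L[ℂ] Fock) ∈ carStarSubalgebra :=
  mem_of_isClosed (S := carStarSubalgebra.comap
      ((e.conjStarAlgEquiv : (Fock →L[ℂ] Fock) →⋆ₐ[ℂ] (Fock →L[ℂ] Fock)).comp
        carStarSubalgebra.subtype))
    ((StarSubalgebra.isClosed_topologicalClosure _).preimage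
      ((StarAlgEquiv.isometry e.conjStarAlgEquiv).continuous.comp continuous_subtype_val)) he a

theorem conj_fockUnitary_mem (U : EllTwo ℤ ≃ₗᵢ[ℂ] EllTwo ℤ) (a : CAR) :
    (fockUnitary U).conjStarAlgEquiv (a : Fock →L[ℂ] Fock) ∈ carStarSubalgebra := by
  refine conj_mem (fun j => ?_) a
  have h := conj_fockUnitary_cStarOf U (lp.single 2 j 1)
  rw [cStarOf_single] at h
  have h' := congrArg star h
  rw [← map_star, ← StarMemClass.coe_star, star_star] at h'
  change (fockUnitary U).conjStarAlgEquiv (c j : Fock →L[ℂ] Fock) ∈ carStarSubalgebra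
  rw [h']
  exact (star (cStarOf (U (lp.single 2 j 1)))).2

theorem conj_fockUnitary_conj_inv (U V : EllTwo ℤ ≃ₗᵢ[ℂ] EllTwo ℤ) (h : U * V = 1)
    (x : Fock →L[ℂ] Fock) :
    (fockUnitary U).conjStarAlgEquiv ((fockUnitary V).conjStarAlgEquiv x) = x := by
  ext1 ψ
  change fockMap U (fockMap V (x (fockMap V⁻¹ (fockMap U⁻¹ ψ)))) = x ψ
  rw [← fockMap_mul_apply, ← fockMap_mul_apply, ← mul_inv_rev, h, inv_one, fockMap_one_apply,
    fockMap_one_apply]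

/-- The quasi-free automorphism of the CAR algebra given by a one-particle unitary. -/
def secondQuantization (U : EllTwo ℤ ≃ₗᵢ[ℂ] EllTwo ℤ) : Aut where
  toFun := fun x => ⟨(fockUnitary U).conjStarAlgEquiv x, conj_fockUnitary_mem U x⟩
  invFun := fun x => ⟨(fockUnitary U⁻¹).conjStarAlgEquiv x, conj_fockUnitary_mem U⁻¹ x⟩
  left_inv := fun x => Subtype.ext (conj_fockUnitary_conj_inv U⁻¹ U (inv_mul_cancel U) x)
  right_inv := fun x => Subtype.ext (conj_fockUnitary_conj_inv U U⁻¹ (mul_inv_cancel U) x)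
  map_mul' := fun x y => Subtype.ext (map_mul (fockUnitary U).conjStarAlgEquiv x.1 y.1)
  map_add' := fun x y => Subtype.ext (map_add (fockUnitary U).conjStarAlgEquiv x.1 y.1)
  map_star' := fun x => Subtype.ext (map_star (fockUnitary U).conjStarAlgEquiv x.1)
  map_smul' := fun z x => Subtype.ext (map_smul (fockUnitary U).conjStarAlgEquiv z x.1)

theorem secondQuantization_cStarOf (U : EllTwo ℤ ≃ₗᵢ[ℂ] EllTwo ℤ) (f : EllTwo ℤ) :
    secondQuantization U (cStarOf f) = cStarOf (U f) :=
  Subtype.ext (conj_fockUnitary_cStarOf U f)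

theorem isometry_secondQuantization (U : EllTwo ℤ ≃ₗᵢ[ℂ] EllTwo ℤ) :
    Isometry (secondQuantization U) := fun x y =>
  StarAlgEquiv.isometry (fockUnitary U).conjStarAlgEquiv x.1 y.1

theorem isometry_discreteShift (i : ℤ) : Isometry (discreteShift i) := fun x y =>
  StarAlgEquiv.isometry (fockShift i).conjStarAlgEquiv x.1 y.1

/-- Continuous automorphisms of the CAR algebra are determined by their values on the `c_j^*`. -/
theorem aut_ext {φ χ : Aut} (hφ : Continuous φ) (hχ : Continuous χ)
    (h : ∀ j, φ (star (c j)) = χ (star (c j))) : φ = χ := by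
  ext1 a
  refine mem_of_isClosed
    (S := StarAlgHom.equalizer (φ : CAR →⋆ₐ[ℂ] CAR) (χ : CAR →⋆ₐ[ℂ] CAR))
    (isClosed_eq hφ hχ) (fun j => ?_) a
  change φ (c j) = χ (c j)
  rw [← star_star (c j), map_star φ, map_star χ, h]

theorem secondQuantization_star_c (U : EllTwo ℤ ≃ₗᵢ[ℂ] EllTwo ℤ) (j : ℤ) :
    secondQuantization U (star (c j)) = cStarOf (U (lp.single 2 j (1 : ℂ))) := by
  rw [← cStarOf_single, secondQuantization_cStarOf]

theorem secondQuantization_one : secondQuantization 1 = 1 := by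
  refine aut_ext (isometry_secondQuantization 1).continuous continuous_id fun j => ?_
  rw [secondQuantization_star_c]
  exact cStarOf_single j

theorem secondQuantization_mul (U V : EllTwo ℤ ≃ₗᵢ[ℂ] EllTwo ℤ) :
    secondQuantization (U * V) = secondQuantization U * secondQuantization V := by
  refine aut_ext (isometry_secondQuantization _).continuous
    ((isometry_secondQuantization U).continuous.comp (isometry_secondQuantization V).continuous)
    fun j => ?_
  change _ = secondQuantization U (secondQuantization V (star (c j)))
  rw [secondQuantization_star_c, secondQuantization_star_c, secondQuantization_cStarOf]
  rfl

/-- Second quantization of a strongly continuous unitary group is strongly continuous. -/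
theorem continuous_secondQuantization_apply {U : ℝ → (EllTwo ℤ ≃ₗᵢ[ℂ] EllTwo ℤ)}
    (hU : ∀ f, Continuous fun t => U t f) (a : CAR) :
    Continuous fun t => secondQuantization (U t) a := by
  let S : StarSubalgebra ℂ CAR :=
    { carrier := {a | Continuous fun t => secondQuantization (U t) a}
      mul_mem' := fun {a b} ha hb => by
        change Continuous fun t => secondQuantization (U t) (a * b)
        simp only [map_mul]
        exact Continuous.mul ha hb
      add_mem' := fun {a b} ha hb => by
        change Continuous fun t => secondQuantization (U t) (a + b)
        simp only [map_add]
        exact Continuous.add ha hb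
      algebraMap_mem' := fun r => by
        change Continuous fun t => secondQuantization (U t) (algebraMap ℂ CAR r)
        simp only [AlgHomClass.commutes]
        exact continuous_const
      star_mem' := fun {a} ha => by
        change Continuous fun t => secondQuantization (U t) (star a)
        simp only [map_star]
        exact Continuous.star ha }
  refine mem_of_isClosed (S := S) ?_ (fun j => ?_) a
  -- The automorphisms are isometric, so if `b` is close to `a`, the orbit of `b` is close to that
  -- of `a` uniformly in `t`; a uniform limit of continuous orbits is continuous.
  · refine isClosed_of_closure_subset fun a ha => ?_
    refine continuous_of_uniform_approx_of_continuous fun u hu => ?_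
    obtain ⟨ε, hε, hεu⟩ := Metric.mem_uniformity_dist.1 hu
    obtain ⟨b, hb, hab⟩ := Metric.mem_closure_iff.1 ha ε hε
    refine ⟨_, hb, fun t => hεu ?_⟩
    rwa [(isometry_secondQuantization (U t)).dist_eq]
  · rw [← star_star (c j)]
    refine star_mem (S := _) (s := S) ?_
    change Continuous fun t => secondQuantization (U t) (star (c j))
    simp only [secondQuantization_star_c]
    exact continuous_cStarOf.comp (hU _)

/-- The quasi-free flow given by a one-particle unitary group. -/
def secondQuantizationFlow {U : ℝ → (EllTwo ℤ ≃ₗᵢ[ℂ] EllTwo ℤ)} (hU : IsUnitaryGroup U) :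
    CStarFlow where
  toFun := fun t => secondQuantization (U t)
  map_zero := by rw [hU.map_zero, secondQuantization_one]
  map_add := fun s t => by rw [hU.map_add, secondQuantization_mul]
  continuous_apply := continuous_secondQuantization_apply hU.continuous_apply

/-! ### The flow extending the discrete shift -/

theorem secondQuantization_shiftUnitary_intCast (i : ℤ) :
    secondQuantization (shiftUnitary i) = discreteShift i := by
  refine aut_ext (isometry_secondQuantization _).continuous
    (isometry_discreteShift i).continuous fun j => ?_
  rw [secondQuantization_star_c, shiftUnitary_intCast_single, cStarOf_single, map_star,
    discreteShift_c]

/-- For a general unitary the adjoint would produce the complex conjugate of `U e_j`. Here the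
matrix of `U_t` is real, so `c_j` and `c_j^*` evolve by the same coefficients. -/
theorem secondQuantization_shiftUnitary_c (t : ℝ) (j : ℤ) :
    secondQuantization (shiftUnitary t) (c j)
      = cOf (shiftUnitary t (lp.single 2 j (1 : ℂ))) := by
  have hreal : star (shiftUnitary t (lp.single 2 j (1 : ℂ)))
      = shiftUnitary t (lp.single 2 j (1 : ℂ)) := by
    ext l
    rw [lp.star_apply, shiftUnitary_single]
    exact Complex.conj_ofReal _
  rw [← star_star (c j), map_star, secondQuantization_star_c, star_cStarOf, hreal]

theorem secondQuantization_shiftUnitary_cOf (t : ℝ) (f : EllTwo ℤ) :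
    secondQuantization (shiftUnitary t) (cOf f) = cOf (shiftUnitary t f) := by
  have h := (hasSum_cOf f).map (secondQuantization (shiftUnitary t))
    (isometry_secondQuantization _).continuous
  simp only [Function.comp_def, map_smul, secondQuantization_shiftUnitary_c] at h
  exact h.unique (hasSum_smul_cOf (shiftUnitary t) f)

theorem hasSum_secondQuantization_shiftUnitary_c (t : ℝ) (j : ℤ) :
    HasSum (fun l : ℤ => ((Real.sinc (Real.pi * (j + t - l)) : ℝ) : ℂ) • c l)
      (secondQuantization (shiftUnitary t) (c j)) := by
  rw [secondQuantization_shiftUnitary_c]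
  simpa only [shiftUnitary_single] using hasSum_cOf (shiftUnitary t (lp.single 2 j 1))

theorem hasSum_secondQuantization_shiftUnitary_star_c (t : ℝ) (j : ℤ) :
    HasSum (fun l : ℤ => ((Real.sinc (Real.pi * (j + t - l)) : ℝ) : ℂ) • star (c l))
      (secondQuantization (shiftUnitary t) (star (c j))) := by
  rw [secondQuantization_star_c]
  simpa only [shiftUnitary_single] using hasSum_cStarOf (shiftUnitary t (lp.single 2 j 1))

/-! ### Locality -/

theorem c_mem_localAlgebra (j : ℤ) : c j ∈ localAlgebra :=
  Set.mem_iUnion.2 ⟨{j}, StarAlgebra.subset_adjoin ℂ _ ⟨j, by simp, rfl⟩⟩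

theorem star_c_mem_localAlgebra (j : ℤ) : star (c j) ∈ localAlgebra :=
  Set.mem_iUnion.2 ⟨{j}, star_mem (StarAlgebra.subset_adjoin ℂ _ ⟨j, by simp, rfl⟩)⟩

/-- Otherwise `c_j^* c_j + c_j c_j^* = 1` would read `0 = 1`, which the unit vacuum vector refutes.
-/
theorem c_ne_zero (j : ℤ) : c j ≠ 0 := by
  intro h
  have h1 := c_star_anticomm j j
  rw [h, mul_zero, zero_mul, add_zero, if_pos rfl] at h1
  have h2 := congrArg (fun a : CAR => (a : Fock →L[ℂ] Fock) vacuum) h1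
  have h3 : vacuum = 0 := h2.symm
  have h4 := norm_vacuum
  rw [h3, norm_zero] at h4
  exact zero_ne_one h4

theorem c_mul_star_c {i j : ℤ} (h : i ≠ j) : c j * star (c i) = -(star (c i) * c j) := by
  have := c_star_anticomm i j
  rw [if_neg h] at this
  exact eq_neg_of_add_eq_zero_right this

theorem c_mul_c (i j : ℤ) : c i * c j = -(c j * c i) :=
  eq_neg_of_add_eq_zero_left (c_anticomm i j)

/-- The number operator at `l` commutes with `c_j` for `j ≠ l`. -/
theorem number_commute_c {j l : ℤ} (h : j ≠ l) :
    star (c l) * c l * c j = c j * (star (c l) * c l) := by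
  rw [mul_assoc, c_mul_c l j, mul_neg, ← mul_assoc, ← mul_assoc, c_mul_star_c h.symm, neg_mul]

/-- The commutant of the self-adjoint operator `c_l^* c_l` is a `*`-algebra, so it suffices that it
contains the generators at sites other than `l`. -/
theorem number_commute_of_mem_localAt {I : Finset ℤ} {l : ℤ} (hl : l ∉ I) {a : CAR}
    (ha : a ∈ localAt I) : star (c l) * c l * a = a * (star (c l) * c l) := by
  induction ha using StarAlgebra.adjoin_induction with
  | mem x hx =>
    obtain ⟨j, hj, rfl⟩ := hx
    exact number_commute_c fun h => hl (h ▸ hj)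
  | algebraMap r => exact (Algebra.commutes r _).symm
  | add x y _ _ hx hy => rw [mul_add, add_mul, hx, hy]
  | mul x y _ _ hx hy => rw [← mul_assoc, hx, mul_assoc, hy, mul_assoc]
  | star x _ hx =>
    have h := congrArg star hx
    simp only [star_mul, star_star] at h
    exact h.symm

/-- Removing a particle at `l` lowers the number there by one. Together with `number_commute_c` this
lets the commutator with `c_l^* c_l` read off the coefficient of `c_l` in a series. -/
theorem number_commutator_c_self (l : ℤ) :
    star (c l) * c l * c l - c l * (star (c l) * c l) = -c l := by
  have h1 : c l * c l = 0 := by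
    have := c_anticomm l l
    rw [← two_smul ℂ] at this
    exact (smul_eq_zero.1 this).resolve_left two_ne_zero
  have h2 : c l * star (c l) = 1 - star (c l) * c l := by
    have := c_star_anticomm l l
    rw [if_pos rfl] at this
    exact eq_sub_of_add_eq' this
  rw [mul_assoc, h1, mul_zero, ← mul_assoc, h2, sub_mul, mul_assoc, h1, mul_zero, one_mul]
  simp

/-- A norm-convergent sum `∑_l s_l c_l` with infinitely many non-zero coefficients is not strictly
local. -/
theorem notMem_localAlgebra_of_hasSum {s : ℤ → ℂ} {a : CAR}
    (hs : {l | s l ≠ 0}.Infinite) (ha : HasSum (fun l => s l • c l) a) : a ∉ localAlgebra := by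
  intro hmem
  obtain ⟨I, hI⟩ := Set.mem_iUnion.1 hmem
  -- A site outside the supposed region with non-zero coefficient: the commutator of `a` with the
  -- number operator there is `-s_l c_l ≠ 0`, yet locality in `I` forces it to vanish.
  obtain ⟨l, hl, hlI⟩ := hs.exists_notMem_finset I
  have h1 : HasSum (fun j => s j • (star (c l) * c l * c j - c j * (star (c l) * c l)))
      (star (c l) * c l * a - a * (star (c l) * c l)) := by
    simpa only [smul_mul_assoc, mul_smul_comm, ← smul_sub] using
      (ha.mul_left (star (c l) * c l)).sub (ha.mul_right (star (c l) * c l))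
  have h2 : HasSum (fun j => s j • (star (c l) * c l * c j - c j * (star (c l) * c l)))
      (s l • -c l) := by
    rw [← number_commutator_c_self]
    refine hasSum_single l fun j hj => ?_
    rw [number_commute_c hj, sub_self, smul_zero]
  have h3 := h1.unique h2
  rw [number_commute_of_mem_localAt hlI hI, sub_self] at h3
  exact (smul_ne_zero hl (neg_ne_zero.2 (c_ne_zero l))) h3.symm

end ShiftFlow

end

theorem proposition2p1 :
    ∃ τ : CStarFlow,
      -- the flow extends the discrete shift group
      (∀ i : ℤ, τ (i : ℝ) = discreteShift i) ∧
      -- it is the second quantization of multiplication by `e^{itk}` on `L²[-π, π]`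
      (∀ f : EllTwo ℤ, Summable (fun j => f j • c j) ∧ Summable (fun j => f j • star (c j))) ∧
      IsQuasiFree τ shiftUnitary ∧
      (∀ (t : ℝ) (f : EllTwo ℤ), τ t (cOf f) = cOf (shiftUnitary t f)) ∧
      -- explicit formulas at non-integer times, as norm-convergent sums
      (∀ (j : ℤ) (t : ℝ), t ∉ Set.range ((↑) : ℤ → ℝ) →
        HasSum (fun l : ℤ => ((Real.sinc (Real.pi * (j + t - l)) : ℝ) : ℂ) • c l)
          (τ t (c j)) ∧
        HasSum (fun l : ℤ =>
            (((-1 : ℝ) ^ (j - l) * Real.sin (Real.pi * t) / (Real.pi * (j + t - l)) : ℝ) : ℂ) • c l)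
          (τ t (c j)) ∧
        HasSum (fun l : ℤ => ((Real.sinc (Real.pi * (j + t - l)) : ℝ) : ℂ) • star (c l))
          (τ t (star (c j))) ∧
        HasSum (fun l : ℤ =>
            (((-1 : ℝ) ^ (j - l) * Real.sin (Real.pi * t) / (Real.pi * (j + t - l)) : ℝ) : ℂ)
              • star (c l))
          (τ t (star (c j)))) ∧
      -- explicit formulas at integer times
      (∀ j k : ℤ,
        τ (k : ℝ) (c j) = c (j + k) ∧ τ (k : ℝ) (c j) ∈ localAlgebra ∧
        τ (k : ℝ) (star (c j)) = star (c (j + k)) ∧ τ (k : ℝ) (star (c j)) ∈ localAlgebra) ∧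
      -- violation of locality at every non-integer time
      (∀ t : ℝ, t ∉ Set.range ((↑) : ℤ → ℝ) →
        ∃ A ∈ localAlgebra, τ t A ∉ localAlgebra) := by
  refine ⟨secondQuantizationFlow isUnitaryGroup_shiftUnitary,
    secondQuantization_shiftUnitary_intCast,
    fun f => ⟨summable_smul_c f, (hasSum_cStarOf f).summable⟩,
    ⟨isUnitaryGroup_shiftUnitary, fun t => secondQuantization_cStarOf (shiftUnitary t)⟩,
    secondQuantization_shiftUnitary_cOf, fun j t ht => ?_, fun j k => ?_, fun t ht => ?_⟩
  · have h1 := hasSum_secondQuantization_shiftUnitary_c t j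
    have h2 := hasSum_secondQuantization_shiftUnitary_star_c t j
    refine ⟨h1, ?_, h2, ?_⟩
    · simp only [sinc_eq_of_notMem_range ht] at h1
      exact h1
    · simp only [sinc_eq_of_notMem_range ht] at h2
      exact h2
  · change secondQuantization (shiftUnitary k) (c j) = _
      ∧ secondQuantization (shiftUnitary k) (c j) ∈ _
      ∧ secondQuantization (shiftUnitary k) (star (c j)) = _
      ∧ secondQuantization (shiftUnitary k) (star (c j)) ∈ _
    rw [secondQuantization_shiftUnitary_intCast, map_star, discreteShift_c]
    exact ⟨rfl, c_mem_localAlgebra _, rfl, star_c_mem_localAlgebra _⟩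
  -- A single annihilation operator already witnesses non-locality, its evolved coefficients being
  -- non-zero at every site.
  · refine ⟨c 0, c_mem_localAlgebra 0, notMem_localAlgebra_of_hasSum ?_
      (hasSum_secondQuantization_shiftUnitary_c t 0)⟩
    convert Set.infinite_univ (α := ℤ)
    refine Set.eq_univ_of_forall fun l => ?_
    exact Complex.ofReal_ne_zero.2 (sinc_ne_zero_of_notMem_range ht 0 l)
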